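/- Let $\mathcal M$ be a regular matroid on a finite ground set $E$, represented over $\mathbb R$ by a totally unimodular matrix $M$ with columns indexed by $E$. An *arc* is a vector of $\mathbb R^E$ with one entry equal to $\pm1$ and all other entries $0$; each edge $e\in E$ carries two opposite arcs. A *fourientation* is a set $F$ of arcs; $-F$ denotes the set of the opposites of the arcs of $F$, and $F^c$ the complement of $F$ in the set of all arcs. An edge is *bioriented* in $F$ if both of its arcs are in $F$, and *one-way oriented* if exactly one is. An *orientation* is a fourientation in which every edge is one-way oriented. A *signed circuit* (resp. *signed cocircuit*) is a $\{0,\pm1\}$-vector in $\ker M$ (resp. in $\operatorname{im} M^{T}$) whose support is a circuit (resp. a cocircuit) of $\mathcal M$; it is regarded as the set of arcs given by its nonzero entries. A *potential circuit* of a fourientation $F$ is a signed circuit $C\subseteq F$; a *potential cocircuit* of $F$ is a signed cocircuit $C^*\subseteq -F^c$. Replacing a signed circuit (resp. signed cocircuit) $C$ contained in an orientation by $-C$ is a *circuit* (resp. *cocircuit*) *reversal*; the classes of the equivalence relation on orientations generated by all circuit and cocircuit reversals are the *circuit-cocircuit reversal classes*, and $[O]$ is the class of $O$. An *external atlas* $\mathcal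 A$ assigns to every basis $B$ of $\mathcal M$ a fourientation $\overrightarrow{B}$ in which the edges of $B$ are bioriented and the edges of $E\setminus B$ are one-way oriented. An *internal atlas* $\mathcal A^*$ assigns to every basis $B$ a fourientation $\overrightarrow{B^*}$ in which the edges of $E\setminus B$ are bioriented and the edges of $B$ are one-way oriented. The atlas $\mathcal A$ is *dissecting* (resp. *triangulating*) if for any two distinct bases $B_1,B_2$ the fourientation $\overrightarrow{B_1}\cap(-\overrightarrow{B_2})$ has a potential cocircuit (resp. has no potential circuit). The atlas $\mathcal A^*$ is *dissecting* (resp. *triangulating*) if for any two distinct bases $B_1,B_2$ the fourientation $\bigl(\overrightarrow{B_1^*}\cap(-\overrightarrow{B_2^*})\bigr)^c$ has a potential circuit (resp. has no potential cocircuit). **Theorem.** Let $\mathcal A$ be an external atlas and $\mathcal A^*$ an internal atlas of $\mathcal M$. Suppose that both are dissecting and that at least one of them is triangulating. Then the map $$B\longmapsto\bigl[\overrightarrow{B}\cap\overrightarrow{B^*}\bigr]$$ from the set of bases of $\mathcal M$ to the set of circuit-cocircuit reversal classes of $\mathcal M$ is a bijection. -/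

import Mathlib

namespace RegularMatroid

variable {E m : Type*}

/-- The matrix `A`, with columns indexed by the type `E`, represents the matroid `M` over `ℝ`:
the ground set of `M` is all of `E`, and a set of edges is independent in `M` if and only if the
corresponding family of columns of `A` is linearly independent. -/
structure Represents (A : Matrix m E ℝ) (M : Matroid E) : Prop where
  ground_eq : M.E = Set.univ
  indep_iff : ∀ I : Set E, M.Indep I ↔ LinearIndepOn ℝ A.col I

/-- The type of bases of a matroid. -/
abbrev Basis (M : Matroid E) : Type _ := {B : Set E // M.IsBase B}

/-- An arc is an edge together with a sign: `(e, 1)` and `(e, -1)` stand for the two vectors of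
`ℝ^E` whose `e`-th entry is `1`, respectively `-1`, and whose other entries vanish. -/
abbrev Arc (E : Type*) : Type _ := E × ℤˣ

/-- A fourientation is an arbitrary set of arcs. -/
abbrev Fourientation (E : Type*) : Type _ := Set (Arc E)

/-- The fourientation `-F`, obtained by reversing all the arcs of `F`. -/
def reverse (F : Fourientation E) : Fourientation E := {a | (a.1, -a.2) ∈ F}

/-- A `{0, 1, -1}`-vector viewed as a set of arcs: an edge contributes the arc whose sign is
the entry of the vector at this edge, and nothing when that entry is `0`. -/
def arcsOf (v : E → ℝ) : Fourientation E := {a | v a.1 = ((a.2 : ℤ) : ℝ)}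

/-- A signed circuit: a `{0, 1, -1}`-vector in the kernel of `A` whose support is a circuit of
`M`, viewed as a set of arcs. -/
def IsSignedCircuit [Fintype E] (A : Matrix m E ℝ) (M : Matroid E) (C : Fourientation E) : Prop :=
  ∃ v : E → ℝ, (∀ e, v e = 0 ∨ v e = 1 ∨ v e = -1) ∧ v ∈ LinearMap.ker A.mulVecLin ∧
    M.IsCircuit (Function.support v) ∧ C = arcsOf v

/-- A signed cocircuit: a `{0, 1, -1}`-vector in the image of the transpose of `A` whose support
is a cocircuit of `M`, viewed as a set of arcs. -/
def IsSignedCocircuit [Fintype m] (A : Matrix m E ℝ) (M : Matroid E) (C : Fourientation E) : Prop :=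
  ∃ v : E → ℝ, (∀ e, v e = 0 ∨ v e = 1 ∨ v e = -1) ∧
    v ∈ LinearMap.range A.transpose.mulVecLin ∧
    M.IsCocircuit (Function.support v) ∧ C = arcsOf v

/-- A potential circuit of `F` is a signed circuit contained in `F`. -/
def IsPotentialCircuit [Fintype E] (A : Matrix m E ℝ) (M : Matroid E)
    (F C : Fourientation E) : Prop :=
  IsSignedCircuit A M C ∧ C ⊆ F

/-- A potential cocircuit of `F` is a signed cocircuit contained in `-Fᶜ`. -/
def IsPotentialCocircuit [Fintype m] (A : Matrix m E ℝ) (M : Matroid E)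
    (F C : Fourientation E) : Prop :=
  IsSignedCocircuit A M C ∧ C ⊆ reverse Fᶜ

/-- The edge `e` is bioriented in `F`: both of its arcs lie in `F`. -/
def IsBioriented (F : Fourientation E) (e : E) : Prop := ∀ s : ℤˣ, (e, s) ∈ F

/-- The edge `e` is one-way oriented in `F`: exactly one of its two arcs lies in `F`. -/
def IsOneWay (F : Fourientation E) (e : E) : Prop := ∃! s : ℤˣ, (e, s) ∈ F

/-- An orientation is a set of arcs in which each edge appears exactly once. -/
structure EdgeOrientation (E : Type*) where
  arcs : Fourientation E
  isOneWay : ∀ e, IsOneWay arcs e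

/-- `O'` is obtained from `O` by one circuit reversal or one cocircuit reversal: some signed
circuit or signed cocircuit `C ⊆ O` is replaced by `-C`. -/
def IsReversal [Fintype E] [Fintype m] (A : Matrix m E ℝ) (M : Matroid E)
    (O O' : EdgeOrientation E) : Prop :=
  ∃ C : Fourientation E, (IsSignedCircuit A M C ∨ IsSignedCocircuit A M C) ∧ C ⊆ O.arcs ∧
    O'.arcs = (O.arcs \ C) ∪ reverse C

/-- The equivalence relation on orientations generated by circuit and cocircuit reversals. -/
def reversalSetoid [Fintype E] [Fintype m] (A : Matrix m E ℝ) (M : Matroid E) :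
    Setoid (EdgeOrientation E) :=
  Relation.EqvGen.setoid (IsReversal A M)

/-- The circuit-cocircuit reversal classes. -/
abbrev ReversalClass [Fintype E] [Fintype m] (A : Matrix m E ℝ) (M : Matroid E) : Type _ :=
  Quotient (reversalSetoid A M)

/-- An external atlas: a choice, for each basis `B`, of one externally oriented basis `orient B`,
a fourientation in which the edges of `B` are bioriented and the other edges are one-way
oriented. -/
structure ExternalAtlas (M : Matroid E) where
  orient : Basis M → Fourientation E
  internal : ∀ (B : Basis M) (e : E), e ∈ B.1 → IsBioriented (orient B) e
  external : ∀ (B : Basis M) (e : E), e ∉ B.1 → IsOneWay (orient B) e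

/-- An internal atlas: a choice, for each basis `B`, of one internally oriented basis `orient B`,
a fourientation in which the edges outside `B` are bioriented and the edges of `B` are one-way
oriented. -/
structure InternalAtlas (M : Matroid E) where
  orient : Basis M → Fourientation E
  internal : ∀ (B : Basis M) (e : E), e ∈ B.1 → IsOneWay (orient B) e
  external : ∀ (B : Basis M) (e : E), e ∉ B.1 → IsBioriented (orient B) e

namespace ExternalAtlas

/-- For distinct bases, `B₁ ∩ (-B₂)` (as oriented in the atlas) has a potential cocircuit. -/
def IsDissecting [Fintype m] {M : Matroid E} (𝒜 : ExternalAtlas M) (A : Matrix m E ℝ) : Prop :=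
  ∀ B₁ B₂ : Basis M, B₁ ≠ B₂ →
    ∃ C, IsPotentialCocircuit A M (𝒜.orient B₁ ∩ reverse (𝒜.orient B₂)) C

/-- For distinct bases, `B₁ ∩ (-B₂)` (as oriented in the atlas) has no potential circuit. -/
def IsTriangulating [Fintype E] {M : Matroid E} (𝒜 : ExternalAtlas M)
    (A : Matrix m E ℝ) : Prop :=
  ∀ B₁ B₂ : Basis M, B₁ ≠ B₂ →
    ¬ ∃ C, IsPotentialCircuit A M (𝒜.orient B₁ ∩ reverse (𝒜.orient B₂)) C

end ExternalAtlas

namespace InternalAtlas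

/-- For distinct bases, `(B₁ ∩ (-B₂))ᶜ` (as oriented in the atlas) has a potential circuit. -/
def IsDissecting [Fintype E] {M : Matroid E} (𝒜 : InternalAtlas M) (A : Matrix m E ℝ) : Prop :=
  ∀ B₁ B₂ : Basis M, B₁ ≠ B₂ →
    ∃ C, IsPotentialCircuit A M (𝒜.orient B₁ ∩ reverse (𝒜.orient B₂))ᶜ C

/-- For distinct bases, `(B₁ ∩ (-B₂))ᶜ` (as oriented in the atlas) has no potential cocircuit. -/
def IsTriangulating [Fintype m] {M : Matroid E} (𝒜 : InternalAtlas M)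
    (A : Matrix m E ℝ) : Prop :=
  ∀ B₁ B₂ : Basis M, B₁ ≠ B₂ →
    ¬ ∃ C, IsPotentialCocircuit A M (𝒜.orient B₁ ∩ reverse (𝒜.orient B₂))ᶜ C

end InternalAtlas

/-- The orientation attached to the basis `B` by a pair of atlases: the intersection of the
externally oriented basis and the internally oriented basis of `B`. -/
def orientationOfBasis {M : Matroid E} (𝒜 : ExternalAtlas M) (𝒜' : InternalAtlas M)
    (B : Basis M) : EdgeOrientation E where
  arcs := 𝒜.orient B ∩ 𝒜'.orient B
  isOneWay := by
    intro e
    by_cases he : e ∈ B.1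
    · obtain ⟨s, hs, hu⟩ := 𝒜'.internal B e he
      exact ⟨s, ⟨𝒜.internal B e he s, hs⟩, fun t ht => hu t ht.2⟩
    · obtain ⟨s, hs, hu⟩ := 𝒜.external B e he
      exact ⟨s, ⟨hs, 𝒜'.external B e he s⟩, fun t ht => hu t ht.1⟩

end RegularMatroid

namespace RegularMatroid

open Matrix

variable {E m : Type*}

/-! Injectivity comes from orthogonality, surjectivity from counting.

Identify an orientation with a ±1-vector. A reversal subtracts twice a sign vector of the kernel or
of the row space of `A`, so equivalent orientations differ by `2(u + w)` with `u` an integer kernel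
vector and `w` an integer row-space vector. Since `u + w` has entries 0, ±1 and `u ⬝ᵥ w = 0`, the
supports of `u` and `w` are disjoint (`IsSignVector.eq_zero_or_eq_zero`). Conversely, total
unimodularity lets signed circuits be peeled off `u` and signed cocircuits off `w`, so this relation
is exactly reversal equivalence.

Suppose two distinct bases give equivalent orientations and the external atlas is triangulating. A
signed circuit inside `u` would be a forbidden potential circuit, so `u = 0`. The internal atlas
supplies a signed circuit `c` whose signs never agree with those of `w`; as `c ⬝ᵥ w = 0`, `w`
vanishes on the support of `c`. There the two orientations agree, which makes `c` a forbidden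
potential circuit of the external fourientation. The other case is dual.

For the count, let `N` consist of rows of `A` forming a basis of the row space. Reversal classes
embed into the cokernel of the integer matrix `N Nᵀ`, of order `det (N Nᵀ)`. By Cauchy–Binet this is
a sum of squared maximal minors, each 0 or 1, and nonzero ones come from bases. -/

/-! ### Elementary vectors of a subspace. -/

/-- A nonzero vector of `K` whose support is minimal among the nonzero vectors of `K`. -/
structure IsElementary (K : Submodule ℝ (E → ℝ)) (v : E → ℝ) : Prop where
  mem : v ∈ K
  ne_zero : v ≠ 0
  support_eq : ∀ z ∈ K, z ≠ 0 → Function.support z ⊆ Function.support v →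
    Function.support z = Function.support v

/-- All entries of the vector are `0`, `1` or `-1`. -/
def IsSignVector (v : E → ℝ) : Prop := ∀ e, v e = 0 ∨ v e = 1 ∨ v e = -1

/-- Every elementary vector of `K` is a multiple of a `{0, 1, -1}`-vector. -/
def IsRegularSubspace (K : Submodule ℝ (E → ℝ)) : Prop :=
  ∀ v, IsElementary K v → ∀ e, v e = 1 → IsSignVector v

theorem IsSignVector.neg {v : E → ℝ} (hv : IsSignVector v) : IsSignVector (-v) := by
  intro e
  rcases hv e with h | h | h <;> simp [h]

theorem IsElementary.smul {K : Submodule ℝ (E → ℝ)} {v : E → ℝ} (hv : IsElementary K v)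
    {c : ℝ} (hc : c ≠ 0) : IsElementary K (c • v) where
  mem := K.smul_mem c hv.mem
  ne_zero := smul_ne_zero hc hv.ne_zero
  support_eq := by
    have h : Function.support (c • v) = Function.support v := by
      ext e; simp [hc]
    rw [h]
    exact hv.support_eq

/-- Subtracting `z e • v` kills the entry at `e`, so the difference has strictly smaller support
than `v` and must vanish. -/
theorem IsElementary.eq_smul {K : Submodule ℝ (E → ℝ)} {v z : E → ℝ} (hv : IsElementary K v)
    (hz : z ∈ K) (hzv : Function.support z ⊆ Function.support v) {e : E} (he : v e = 1) :
    z = z e • v := by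
  by_contra hne
  have h := hv.support_eq (z - z e • v) (K.sub_mem hz (K.smul_mem _ hv.mem))
    (sub_ne_zero.2 hne) (by
      intro f hf hvf
      have hzf : z f = 0 := by
        by_contra h; exact hzv h hvf
      exact hf (by simp [hzf, hvf]))
  have : e ∈ Function.support (z - z e • v) := by rw [h]; simp [he]
  exact this (by simp [he])

/-- Every nonzero vector `x` of `K` dominates an elementary vector of `K` with the same signs. -/
theorem exists_isElementary_conformal [Finite E] {K : Submodule ℝ (E → ℝ)} {x : E → ℝ}
    (hx : x ∈ K) (hx0 : x ≠ 0) :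
    ∃ v, IsElementary K v ∧ ∀ e, v e ≠ 0 → 0 < v e * x e := by
  classical
  have := Fintype.ofFinite E
  -- Among the vectors of `K` conforming to `x`, take one of smallest support; minimality among all
  -- of `K` has to be deduced.
  let P : ℕ → Prop := fun n => ∃ v ∈ K, v ≠ 0 ∧ (∀ e, v e ≠ 0 → 0 < v e * x e) ∧
    (Function.support v).ncard = n
  have hP : ∃ n, P n := ⟨_, x, hx, hx0, fun e he => mul_self_pos.2 he, rfl⟩
  obtain ⟨v, hvK, hv0, hvx, hcard⟩ := Nat.find_spec hP
  have hmin : ∀ y ∈ K, y ≠ 0 → (∀ e, y e ≠ 0 → 0 < y e * x e) →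
      Function.support y ⊆ Function.support v → Function.support y = Function.support v := by
    intro y hy hy0 hyx hyv
    refine Set.eq_of_subset_of_ncard_le hyv ?_ (Set.toFinite _)
    rw [hcard]
    exact Nat.find_min' hP ⟨y, hy, hy0, hyx, rfl⟩
  refine ⟨v, ⟨hvK, hv0, fun z hz hz0 hzv => ?_⟩, hvx⟩
  by_contra hne
  -- make some entry of `z` have the sign of the entry of `v`
  obtain ⟨z, hz, hz0, hzv, hne, e₀, he₀⟩ : ∃ z ∈ K, z ≠ 0 ∧
      Function.support z ⊆ Function.support v ∧ Function.support z ≠ Function.support v ∧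
      ∃ e, 0 < z e * v e := by
    obtain ⟨e, he⟩ := Function.ne_iff.1 hz0
    have hve : v e ≠ 0 := hzv he
    rcases lt_or_gt_of_ne (mul_ne_zero he hve) with h | h
    · exact ⟨-z, K.neg_mem hz, neg_ne_zero.2 hz0, by simpa using hzv, by simpa using hne, e,
        by simpa using h⟩
    · exact ⟨z, hz, hz0, hzv, hne, e, h⟩
  let T : Finset E := Finset.univ.filter fun e => 0 < z e * v e
  obtain ⟨f, hfT, hf⟩ := T.exists_min_image (fun e => v e / z e) ⟨e₀, by simpa [T] using he₀⟩
  have hfpos : 0 < z f * v f := by simpa [T] using hfT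
  have hzf : z f ≠ 0 := left_ne_zero_of_mul hfpos.ne'
  have hvf : v f ≠ 0 := right_ne_zero_of_mul hfpos.ne'
  -- The smallest ratio over the entries where `z` and `v` agree in sign: `v - t • z` loses the
  -- entry `f` while no entry changes sign, so it still conforms to `x`.
  set t := v f / z f with ht
  have htpos : 0 < t := by
    rw [ht, div_eq_mul_inv, ← mul_inv_cancel_right₀ hzf (v f), mul_assoc, mul_assoc]
    have : 0 < (z f)⁻¹ * (z f)⁻¹ := mul_self_pos.2 (inv_ne_zero hzf)
    nlinarith [mul_pos hfpos this]
  let y := v - t • z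
  have hy : ∀ e, y e = v e - t * z e := fun e => rfl
  have hyv : Function.support y ⊆ Function.support v := by
    intro e he hve
    have hze : z e = 0 := by
      by_contra h; exact hzv h hve
    exact he (by simp [hy, hze, hve])
  have hyK : y ∈ K := K.sub_mem hvK (K.smul_mem _ hz)
  have hyf : y f = 0 := by rw [hy, ht]; field_simp; simp
  have hy0 : y ≠ 0 := by
    intro h0
    refine hne (Set.Subset.antisymm hzv fun e he hze => he ?_)
    have := congrFun h0 e
    rw [hy, hze] at this
    simpa using this
  have hconf : ∀ e, y e ≠ 0 → 0 < y e * x e := by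
    intro e he
    have hve : v e ≠ 0 := hyv he
    have h1 := hvx e hve
    have hxe : x e ≠ 0 := right_ne_zero_of_mul h1.ne'
    have h2 : 0 ≤ y e * v e := by
      rw [hy]
      by_cases hc : 0 < z e * v e
      · have h3 : t ≤ v e / z e := hf e (by simpa [T] using hc)
        have hze : z e ≠ 0 := left_ne_zero_of_mul hc.ne'
        have : (v e - t * z e) * v e = (v e / z e - t) * (z e * v e) := by field_simp
        rw [this]
        exact mul_nonneg (sub_nonneg.2 h3) hc.le
      · nlinarith [mul_self_nonneg (v e), mul_nonneg htpos.le (neg_nonneg.2 (not_lt.1 hc))]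
    have h3 : 0 < y e * v e := lt_of_le_of_ne h2 (mul_ne_zero he hve).symm
    have h4 : 0 < (y e * x e) * (v e * v e) := by nlinarith [mul_pos h3 h1]
    exact pos_of_mul_pos_left h4 (mul_self_nonneg _)
  have := hmin y hyK hy0 hconf hyv
  exact (this ▸ (show f ∈ Function.support v from hvf) : f ∈ Function.support y) hyf

/-- Divide a conformal elementary vector by the absolute value of one of its entries: regularity
makes it a sign vector, and equal signs then mean equal entries. -/
theorem IsRegularSubspace.exists_isElementary [Finite E] {K : Submodule ℝ (E → ℝ)}
    (hK : IsRegularSubspace K) {x : E → ℝ} (hx : x ∈ K) (hx0 : x ≠ 0) (hxs : IsSignVector x) :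
    ∃ v, IsElementary K v ∧ IsSignVector v ∧ ∀ e, v e ≠ 0 → v e = x e := by
  obtain ⟨v, hv, hvx⟩ := exists_isElementary_conformal hx hx0
  obtain ⟨e, he⟩ := Function.ne_iff.1 hv.ne_zero
  have hs : IsSignVector ((v e)⁻¹ • v) :=
    hK _ (hv.smul (inv_ne_zero he)) e (by simpa using inv_mul_cancel₀ he)
  have hs' : IsSignVector (|v e|⁻¹ • v) := by
    rcases abs_choice (v e) with h | h
    · rwa [h]
    · rw [h, inv_neg, neg_smul]; exact hs.neg
  have hpos : 0 < |v e|⁻¹ := inv_pos.2 (abs_pos.2 he)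
  refine ⟨_, hv.smul hpos.ne', hs', fun f hf => ?_⟩
  have hvf : v f ≠ 0 := right_ne_zero_of_mul (by simpa using hf)
  have h1 : 0 < (|v e|⁻¹ • v) f * x f := by
    simpa [mul_assoc] using mul_pos hpos (hvx f hvf)
  rcases hs' f with h | h | h <;> rcases hxs f with h' | h' | h' <;> rw [h, h'] at h1 ⊢ <;>
    norm_num at h1

/-! ### Total unimodularity makes the kernel and the row space regular. -/

theorem sign_of_mul_mem_range {c d x : ℝ} (hc : c ∈ Set.range SignType.cast)
    (hd : d ∈ Set.range (SignType.cast : SignType → ℝ)) (hc0 : c ≠ 0) (h : c * x = d) :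
    x = 0 ∨ x = 1 ∨ x = -1 := by
  obtain ⟨a, rfl⟩ := hc
  obtain ⟨b, rfl⟩ := hd
  cases a <;> cases b <;> simp at h hc0 ⊢ <;> first | exact Or.inl h | (right; first | (left; linarith) | (right; linarith))

/-- A matrix with linearly independent columns has a nonsingular square submatrix using all
the columns. -/
theorem exists_submatrix_det_ne_zero {n : Type*} [Fintype n] [DecidableEq n]
    (Q : Matrix m n ℝ) (hQ : LinearIndependent ℝ Q.col) [Fintype m] :
    ∃ f : n → m, (Q.submatrix f id).det ≠ 0 := by
  obtain ⟨κ, a, ha, hspan, hli⟩ := exists_linearIndependent' ℝ Q.row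
  have := Fintype.ofInjective a ha
  have hcard : Fintype.card n = Fintype.card κ := by
    rw [← finrank_span_eq_card hli, hspan, ← Matrix.rank_eq_finrank_span_row, ← Matrix.rank_transpose]
    exact (LinearIndependent.rank_matrix (M := Qᵀ) hQ).symm
  let σ : n ≃ κ := Fintype.equivOfCardEq hcard
  refine ⟨a ∘ σ, ?_⟩
  have h2 : LinearIndependent ℝ (Q.submatrix (a ∘ σ) id).row := hli.comp σ σ.injective
  have := Matrix.linearIndependent_rows_iff_isUnit.1 h2
  exact ((Matrix.isUnit_iff_isUnit_det _).1 this).ne_zero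

theorem linearIndepOn_col_iff [Fintype E] {A : Matrix m E ℝ} {I : Set E} :
    LinearIndepOn ℝ A.col I ↔
      ∀ c ∈ LinearMap.ker A.mulVecLin, Function.support c ⊆ I → c = 0 := by
  rw [linearIndepOn_iff]
  have key : ∀ l : E →₀ ℝ, Finsupp.linearCombination ℝ A.col l = A.mulVec l := by
    intro l
    ext i
    rw [Finsupp.linearCombination_apply, Finsupp.sum_fintype _ _ (by simp), Finset.sum_apply]
    exact Finset.sum_congr rfl fun f _ => mul_comm _ _
  constructor
  · intro h c hc hcI
    have := h (Finsupp.equivFunOnFinite.symm c) (by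
      rw [Finsupp.mem_supported]
      intro e he
      exact hcI (by simpa using he)) (by
      rw [key]
      simpa using hc)
    ext e
    simpa using DFunLike.congr_fun this e
  · intro h l hl hl0
    rw [key] at hl0
    have := h l (by simpa using hl0) (by
      intro e he
      exact hl (by simpa using he))
    ext e
    exact congrFun this e

/-- Cramer's rule. Minimality of the support makes its columns other than `e` independent, so the
remaining entries of `v` solve a nonsingular square system with right-hand side minus column `e`;
each is, up to sign, a quotient of two minors of `A`. -/
theorem isRegularSubspace_ker [Fintype E] [Fintype m] {A : Matrix m E ℝ}
    (hA : A.IsTotallyUnimodular) : IsRegularSubspace (LinearMap.ker A.mulVecLin) := by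
  classical
  intro v hv e he
  let p : E → Prop := fun f => v f ≠ 0 ∧ f ≠ e
  let Q : Matrix m {f // p f} ℝ := A.submatrix id Subtype.val
  have hQ : LinearIndependent ℝ Q.col := by
    have : LinearIndepOn ℝ A.col {f | p f} := by
      rw [linearIndepOn_col_iff]
      intro z hz hzp
      rw [hv.eq_smul hz (fun f hf => (hzp hf).1) he]
      have : z e = 0 := by
        by_contra h
        exact (hzp h).2 rfl
      rw [this, zero_smul]
    exact this
  obtain ⟨r, hr⟩ := exists_submatrix_det_ne_zero Q hQ
  have hsum : (Q.submatrix r id).mulVec (fun f => v f) = fun i => - A (r i) e := by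
    ext i
    have h0 : ∑ f, A (r i) f * v f = 0 := congrFun (LinearMap.mem_ker.1 hv.mem) (r i)
    rw [← Finset.sum_erase_add _ _ (Finset.mem_univ e), he, mul_one] at h0
    have h1 : ∑ f ∈ Finset.univ.filter p, A (r i) f * v f =
        ∑ f ∈ Finset.univ.erase e, A (r i) f * v f := by
      refine Finset.sum_subset (fun f hf => ?_) fun f hf hf' => ?_
      · simpa using (Finset.mem_filter.1 hf).2.2
      · have : v f = 0 := by
          by_contra h
          exact hf' (by simp [p, h, Finset.ne_of_mem_erase hf])
        rw [this, mul_zero]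
    rw [Finset.sum_subtype (p := p) _ (by simp)] at h1
    change ∑ f : {f // p f}, A (r i) f * v f = _
    linarith
  have hcr : ∀ f : {f // p f}, (Q.submatrix r id).det * (- v f) =
      ((Q.submatrix r id).updateCol f (fun i => A (r i) e)).det := by
    intro f
    rw [← Matrix.cramer_apply]
    have h1 : (fun i => A (r i) e) = - (Q.submatrix r id).mulVec (fun f => v f) := by
      rw [hsum]; ext; simp
    rw [h1, Matrix.cramer_eq_adjugate_mulVec, Matrix.mulVec_neg, Matrix.mulVec_mulVec,
      Matrix.adjugate_mul, Matrix.smul_mulVec, Matrix.one_mulVec]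
    simp
  rw [isTotallyUnimodular_iff_fintype] at hA
  have hdet := hA {f // p f} r (fun f => f.1)
  intro f
  by_cases hf : p f
  -- The numerator in Cramer's rule is again a minor of `A`: column `e` takes the place of column
  -- `f`.
  · have hup : (Q.submatrix r id).updateCol ⟨f, hf⟩ (fun i => A (r i) e) =
        A.submatrix r (Function.update (fun f => f.1) ⟨f, hf⟩ e) := by
      ext i g
      by_cases hg : g = ⟨f, hf⟩
      · subst hg; simp
      · simp [hg, Q, Matrix.updateCol_ne]
    have h1 := hcr ⟨f, hf⟩
    rw [hup] at h1
    have := sign_of_mul_mem_range hdet (hA _ _ _) hr h1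
    rcases this with h | h | h
    · exact Or.inl (neg_eq_zero.1 h)
    · exact Or.inr (Or.inr (by simp at h; linarith))
    · exact Or.inr (Or.inl (by simp at h; linarith))
  · by_cases h0 : v f = 0
    · exact Or.inl h0
    · have : f = e := by
        by_contra h
        exact hf ⟨h0, h⟩
      exact Or.inr (Or.inl (this ▸ he))

/-- Reduction to the kernel case. Independence of the rows determines `y` from `Aᵀ y`, so a kernel
vector supported inside `(-y, v)` is a multiple of it as soon as its `E`-part is a multiple of `v`.
-/
theorem isRegularSubspace_range [Fintype E] [Fintype m] {A : Matrix m E ℝ}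
    (hA : A.IsTotallyUnimodular) (hrow : LinearIndependent ℝ A.row) :
    IsRegularSubspace (LinearMap.range Aᵀ.mulVecLin) := by
  classical
  intro v hv e he
  have hinj : ∀ y, Aᵀ.mulVec y = 0 → y = 0 := by
    have : Function.Injective Aᵀ.mulVec := Matrix.mulVec_injective_iff.2 hrow
    intro y hy
    exact this (by simpa using hy)
  obtain ⟨y, hy⟩ := hv.mem
  rw [Matrix.mulVecLin_apply] at hy
  -- `(-y, v)` is elementary in the kernel of the totally unimodular matrix `[Aᵀ | 1]`
  let G : Matrix E (m ⊕ E) ℝ := Matrix.fromCols Aᵀ 1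
  have hG : G.IsTotallyUnimodular := (Matrix.fromCols_one_isTotallyUnimodular_iff _).2 hA.transpose
  have hmem : ∀ z : m ⊕ E → ℝ, z ∈ LinearMap.ker G.mulVecLin ↔
      Aᵀ.mulVec (fun i => - z (Sum.inl i)) = fun f => z (Sum.inr f) := by
    intro z
    have : z = Sum.elim (z ∘ Sum.inl) (z ∘ Sum.inr) := by simp
    rw [LinearMap.mem_ker, Matrix.mulVecLin_apply, this, Matrix.fromCols_mulVec_sumElim]
    have h2 : (fun i => - Sum.elim (z ∘ Sum.inl) (z ∘ Sum.inr) (Sum.inl i)) =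
      - (z ∘ Sum.inl) := rfl
    rw [h2, Matrix.mulVec_neg, Matrix.one_mulVec]
    constructor
    · intro h
      ext f
      have := congrFun h f
      simp at this ⊢
      linarith
    · intro h
      ext f
      have := congrFun h f
      simp at this ⊢
      linarith
  let x : m ⊕ E → ℝ := Sum.elim (-y) v
  have hx : IsElementary (LinearMap.ker G.mulVecLin) x := by
    refine ⟨(hmem _).2 (by simpa [x] using hy), ?_, ?_⟩
    · intro h
      have := congrFun h (Sum.inr e)
      simp [x, he] at this
    · intro z hz hz0 hzx
      have hz' := (hmem z).1 hz
      have hzv := hv.eq_smul (z := fun f => z (Sum.inr f)) ⟨_, hz'⟩ (fun f hf => hzx hf) he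
      have h0 : (fun i => - z (Sum.inl i)) - z (Sum.inr e) • y = 0 := by
        apply hinj
        rw [Matrix.mulVec_sub, Matrix.mulVec_smul, hy, hz', ← hzv, sub_self]
      have hzx' : z = z (Sum.inr e) • x := by
        ext g
        rcases g with i | f
        · have := congrFun h0 i
          simp at this
          simp [x]
          linarith
        · exact congrFun hzv f
      have hc : z (Sum.inr e) ≠ 0 := by
        intro h
        rw [h, zero_smul] at hzx'
        exact hz0 hzx'
      rw [hzx']
      ext g
      simp [hc]
  intro f
  exact isRegularSubspace_ker hG x hx (Sum.inr e) he (Sum.inr f)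

/-! ### Supports of elementary vectors are circuits and cocircuits. -/

theorem Represents.indep_iff_ker [Fintype E] {A : Matrix m E ℝ} {M : Matroid E}
    (hA : Represents A M) {I : Set E} :
    M.Indep I ↔ ∀ c ∈ LinearMap.ker A.mulVecLin, Function.support c ⊆ I → c = 0 := by
  rw [hA.indep_iff, linearIndepOn_col_iff]

theorem IsElementary.isCircuit [Fintype E] {A : Matrix m E ℝ} {M : Matroid E}
    (hA : Represents A M) {v : E → ℝ} (hv : IsElementary (LinearMap.ker A.mulVecLin) v) :
    M.IsCircuit (Function.support v) := by
  rw [Matroid.isCircuit_iff_minimal_not_indep (by simp [hA.ground_eq])]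
  refine ⟨fun h => hv.ne_zero (hA.indep_iff_ker.1 h v hv.mem subset_rfl), fun Y hY hYv => ?_⟩
  replace hY := mt hA.indep_iff_ker.2 hY
  push Not at hY
  obtain ⟨c, hc, hcY, hc0⟩ := hY
  rw [← hv.support_eq c hc hc0 (hcY.trans hYv)]
  exact hcY

theorem Represents.col_mem_span_of_isBasis {A : Matrix m E ℝ} {M : Matroid E}
    (hA : Represents A M) {I X : Set E} (hI : M.IsBasis I X) {e : E} (he : e ∈ X) :
    A.col e ∈ Submodule.span ℝ (A.col '' I) := by
  by_contra h
  have h1 : LinearIndepOn ℝ A.col (insert e I) := ((hA.indep_iff I).1 hI.indep).insert h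
  have h2 : e ∈ I := hI.mem_of_insert_indep he ((hA.indep_iff _).2 h1)
  exact h (Submodule.subset_span ⟨e, h2, rfl⟩)

theorem mem_range_transpose_iff [Fintype m] {A : Matrix m E ℝ} {w : E → ℝ} :
    w ∈ LinearMap.range Aᵀ.mulVecLin ↔ ∃ φ : (m → ℝ) →ₗ[ℝ] ℝ, ∀ e, w e = φ (A.col e) := by
  classical
  constructor
  · rintro ⟨y, rfl⟩
    exact ⟨dotProductBilin ℝ ℝ y, fun e => dotProduct_comm _ _⟩
  · rintro ⟨φ, hφ⟩
    refine ⟨fun i => φ (Pi.single i 1), ?_⟩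
    ext e
    rw [hφ, LinearMap.pi_apply_eq_sum_univ φ]
    simp only [Matrix.mulVecLin_apply, Matrix.mulVec, dotProduct, Matrix.transpose_apply,
      Matrix.col_apply, smul_eq_mul]
    refine Finset.sum_congr rfl fun i _ => ?_
    congr 2
    ext j
    simp [Pi.single_apply, eq_comm]

/-- A linear functional vanishing on the columns of a base vanishes on all columns. -/
theorem Represents.support_inter_nonempty [Fintype m] {A : Matrix m E ℝ} {M : Matroid E}
    (hA : Represents A M) {w : E → ℝ} (hw : w ∈ LinearMap.range Aᵀ.mulVecLin) (hw0 : w ≠ 0)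
    {B : Set E} (hB : M.IsBase B) : (Function.support w ∩ B).Nonempty := by
  by_contra h
  rw [Set.not_nonempty_iff_eq_empty, ← Set.disjoint_iff_inter_eq_empty] at h
  obtain ⟨φ, hφ⟩ := mem_range_transpose_iff.1 hw
  have hle : Submodule.span ℝ (A.col '' B) ≤ LinearMap.ker φ := by
    rw [Submodule.span_le]
    rintro _ ⟨e, he, rfl⟩
    rw [SetLike.mem_coe, LinearMap.mem_ker, ← hφ]
    by_contra hne
    exact Set.disjoint_left.1 h hne he
  apply hw0
  ext e
  rw [hφ]
  exact hle (hA.col_mem_span_of_isBasis hB.isBasis_ground (by simp [hA.ground_eq]))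

/-- A maximal independent subset of the complement of `X` is not a base, so some column lies outside
its span; a functional separating that column from the span gives `w`. -/
theorem Represents.exists_mem_range [Fintype m] {A : Matrix m E ℝ} {M : Matroid E}
    (hA : Represents A M) {X : Set E} (hX : ∀ B, M.IsBase B → (X ∩ B).Nonempty) :
    ∃ w ∈ LinearMap.range Aᵀ.mulVecLin, w ≠ 0 ∧ Function.support w ⊆ X := by
  obtain ⟨I, hI⟩ := M.exists_isBasis Xᶜ (by simp [hA.ground_eq])
  have hnB : ¬ M.IsBase I := fun hB => by
    obtain ⟨e, he, heI⟩ := hX I hB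
    exact hI.subset heI he
  obtain ⟨e, he⟩ : ∃ e, A.col e ∉ Submodule.span ℝ (A.col '' I) := by
    by_contra! hall
    refine hnB (hI.indep.isBase_of_forall_insert fun e he hins => ?_)
    have h1 := (hA.indep_iff _).1 hins
    exact (linearIndepOn_insert he.2).1 h1 |>.2 (hall e)
  obtain ⟨φ, hφ, hle⟩ := Submodule.exists_le_ker_of_notMem he
  refine ⟨fun f => φ (A.col f), mem_range_transpose_iff.2 ⟨φ, fun _ => rfl⟩,
    fun h => hφ (congrFun h e), fun f hf => ?_⟩
  by_contra hfX
  exact hf (hle (hA.col_mem_span_of_isBasis hI hfX))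

theorem IsElementary.isCocircuit [Fintype m] {A : Matrix m E ℝ} {M : Matroid E}
    (hA : Represents A M) {v : E → ℝ} (hv : IsElementary (LinearMap.range Aᵀ.mulVecLin) v) :
    M.IsCocircuit (Function.support v) := by
  rw [Matroid.isCocircuit_iff_minimal]
  refine ⟨fun B hB => hA.support_inter_nonempty hv.mem hv.ne_zero hB, fun Y hY hYv => ?_⟩
  obtain ⟨w, hw, hw0, hwY⟩ := hA.exists_mem_range hY
  rw [← hv.support_eq w hw hw0 (hwY.trans hYv)]
  exact hwY

/-! ### Integer vectors and orthogonal decompositions. -/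

/-- All entries of the vector are integers. -/
def IsIntVector (v : E → ℝ) : Prop := ∀ e, ∃ n : ℤ, v e = n

theorem IsSignVector.isIntVector {v : E → ℝ} (hv : IsSignVector v) : IsIntVector v := by
  intro e
  rcases hv e with h | h | h
  · exact ⟨0, by simp [h]⟩
  · exact ⟨1, by simp [h]⟩
  · exact ⟨-1, by simp [h]⟩

theorem IsIntVector.add {v w : E → ℝ} (hv : IsIntVector v) (hw : IsIntVector w) :
    IsIntVector (v + w) := by
  intro e
  obtain ⟨a, ha⟩ := hv e
  obtain ⟨b, hb⟩ := hw e
  exact ⟨a + b, by simp [ha, hb]⟩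

theorem IsIntVector.neg {v : E → ℝ} (hv : IsIntVector v) : IsIntVector (-v) := by
  intro e
  obtain ⟨a, ha⟩ := hv e
  exact ⟨-a, by simp [ha]⟩

theorem isIntVector_zero : IsIntVector (0 : E → ℝ) := fun _ => ⟨0, by simp⟩

theorem dotProduct_eq_zero_of_mem [Fintype E] [Fintype m] {A : Matrix m E ℝ} {u w : E → ℝ}
    (hu : u ∈ LinearMap.ker A.mulVecLin) (hw : w ∈ LinearMap.range Aᵀ.mulVecLin) :
    u ⬝ᵥ w = 0 := by
  obtain ⟨y, rfl⟩ := hw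
  rw [Matrix.mulVecLin_apply, Matrix.dotProduct_mulVec, Matrix.vecMul_transpose]
  rw [LinearMap.mem_ker, Matrix.mulVecLin_apply] at hu
  rw [hu, zero_dotProduct]

/-- An orthogonal decomposition of a `{0, 1, -1}`-vector into integer vectors has disjoint
supports. -/
theorem IsSignVector.eq_zero_or_eq_zero [Fintype E] {u w : E → ℝ} (hx : IsSignVector (u + w))
    (hu : IsIntVector u) (h : u ⬝ᵥ w = 0) (e : E) : u e = 0 ∨ w e = 0 := by
  -- Each summand is `-(u f * w f)`, nonnegative because `u f` is an integer and `|u f + w f| ≤ 1`.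
  -- Orthogonality makes the sum zero, so every summand vanishes.
  have hnn : ∀ f ∈ Finset.univ, 0 ≤ u f * u f - (u f + w f) * u f := by
    intro f _
    obtain ⟨n, hn⟩ := hu f
    have hx' := hx f
    simp only [Pi.add_apply] at hx'
    have h1 : |(n : ℝ)| ≤ n * n := by
      rw [← abs_mul_abs_self]
      rcases eq_or_ne n 0 with rfl | h0
      · simp
      · have : (1 : ℝ) ≤ |(n : ℝ)| := by exact_mod_cast Int.one_le_abs h0
        nlinarith
    rw [hn] at hx' ⊢
    rcases hx' with h | h | h <;> rw [h]
    · nlinarith [mul_self_nonneg (n : ℝ)]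
    · nlinarith [le_abs_self (n : ℝ)]
    · nlinarith [neg_abs_le (n : ℝ)]
  have hsum : ∑ f, (u f * u f - (u f + w f) * u f) = 0 := by
    rw [dotProduct] at h
    rw [← neg_eq_zero, ← Finset.sum_neg_distrib, ← h]
    exact Finset.sum_congr rfl fun f _ => by ring
  have := (Finset.sum_eq_zero_iff_of_nonneg hnn).1 hsum e (Finset.mem_univ _)
  have : u e * w e = 0 := by linarith
  exact mul_eq_zero.1 this

theorem IsSignVector.left {u w : E → ℝ} (hx : IsSignVector (u + w))
    (h : ∀ e, u e = 0 ∨ w e = 0) : IsSignVector u := by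
  intro e
  rcases h e with h | h
  · exact Or.inl h
  · simpa [h] using hx e

/-! ### Orientations as ±1-vectors. -/

theorem mem_arcsOf {v : E → ℝ} {e : E} {s : ℤˣ} :
    (e, s) ∈ arcsOf v ↔ v e = ((s : ℤ) : ℝ) := Iff.rfl

theorem mem_reverse {F : Fourientation E} {e : E} {s : ℤˣ} :
    (e, s) ∈ reverse F ↔ (e, -s) ∈ F := Iff.rfl

namespace EdgeOrientation

/-- The `{1, -1}`-vector of an orientation. -/
noncomputable def vec (O : EdgeOrientation E) (e : E) : ℝ :=
  (((O.isOneWay e).choose : ℤ) : ℝ)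

theorem mem_arcs_iff (O : EdgeOrientation E) {e : E} {s : ℤˣ} :
    (e, s) ∈ O.arcs ↔ O.vec e = ((s : ℤ) : ℝ) := by
  obtain ⟨h1, h2⟩ := (O.isOneWay e).choose_spec
  constructor
  · intro h
    rw [vec, ← h2 s h]
  · intro h
    have : (O.isOneWay e).choose = s := by
      rw [vec] at h
      exact_mod_cast h
    exact this ▸ h1

theorem vec_eq (O : EdgeOrientation E) (e : E) : O.vec e = 1 ∨ O.vec e = -1 := by
  rw [vec]
  rcases Int.units_eq_one_or (O.isOneWay e).choose with h | h <;> simp [h]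

theorem arcs_eq (O : EdgeOrientation E) : O.arcs = arcsOf O.vec := by
  ext ⟨e, s⟩
  exact O.mem_arcs_iff

theorem vec_injective : Function.Injective (vec : EdgeOrientation E → E → ℝ) := by
  intro O O' h
  have h1 : O.arcs = O'.arcs := by rw [arcs_eq, arcs_eq, h]
  cases O; cases O'
  simpa using h1

theorem exists_vec_eq {x : E → ℝ} (hx : ∀ e, x e = 1 ∨ x e = -1) :
    ∃ O : EdgeOrientation E, O.vec = x := by
  have hone : ∀ e, IsOneWay (arcsOf x) e := by
    intro e
    rcases hx e with h | h
    · refine ⟨1, by simp [mem_arcsOf, h], fun s hs => ?_⟩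
      replace hs := mem_arcsOf.1 hs
      rw [h] at hs
      have : ((s : ℤ)) = ((1 : ℤˣ) : ℤ) := by
        push_cast
        exact_mod_cast hs.symm
      exact Units.ext this
    · refine ⟨-1, by simp [mem_arcsOf, h], fun s hs => ?_⟩
      replace hs := mem_arcsOf.1 hs
      rw [h] at hs
      have : ((s : ℤ)) = ((-1 : ℤˣ) : ℤ) := by
        push_cast
        exact_mod_cast hs.symm
      exact Units.ext this
  refine ⟨⟨arcsOf x, hone⟩, ?_⟩
  ext e
  obtain ⟨s, hs, -⟩ := hone e
  rw [(mem_arcs_iff _).1 hs, ← mem_arcsOf.1 hs]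

theorem arcsOf_subset_arcs_iff (O : EdgeOrientation E) {v : E → ℝ} (hv : IsSignVector v) :
    arcsOf v ⊆ O.arcs ↔ ∀ e, v e ≠ 0 → v e = O.vec e := by
  constructor
  · intro h e he
    rcases hv e with h0 | h0 | h0
    · exact absurd h0 he
    · have := O.mem_arcs_iff.1 (h (show (e, 1) ∈ arcsOf v by simp [mem_arcsOf, h0]))
      simp [h0, this]
    · have := O.mem_arcs_iff.1 (h (show (e, -1) ∈ arcsOf v by simp [mem_arcsOf, h0]))
      simp [h0, this]
  · rintro h ⟨e, s⟩ hes
    rw [mem_arcsOf] at hes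
    rw [O.mem_arcs_iff, ← h e, hes]
    rw [hes]
    simp

theorem reversal_iff (O O' : EdgeOrientation E) {v : E → ℝ}
    (hvO : ∀ e, v e ≠ 0 → v e = O.vec e) :
    O'.arcs = (O.arcs \ arcsOf v) ∪ reverse (arcsOf v) ↔ O'.vec = O.vec - (2 : ℝ) • v := by
  have key : ∀ e, (∀ s : ℤˣ, (e, s) ∈ O'.arcs ↔
      (e, s) ∈ (O.arcs \ arcsOf v) ∪ reverse (arcsOf v)) ↔
      O'.vec e = O.vec e - 2 * v e := by
    intro e
    have hall : ∀ p : ℤˣ → Prop, (∀ s, p s) ↔ p 1 ∧ p (-1) := fun p =>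
      ⟨fun h => ⟨h _, h _⟩, fun h s => by
        rcases Int.units_eq_one_or s with rfl | rfl
        exacts [h.1, h.2]⟩
    rw [hall]
    simp only [Set.mem_union, Set.mem_sdiff, mem_reverse, mem_arcsOf, mem_arcs_iff]
    by_cases h0 : v e = 0
    · rcases O.vec_eq e with h1 | h1 <;> rcases O'.vec_eq e with h2 | h2 <;>
        rw [h0, h1, h2] <;> norm_num
    · rw [hvO e h0]
      rcases O.vec_eq e with h1 | h1 <;> rcases O'.vec_eq e with h2 | h2 <;>
        rw [h1, h2] <;> norm_num
  rw [Set.ext_iff, funext_iff]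
  constructor
  · intro h e
    exact (key e).1 fun s => h _
  · rintro h ⟨e, s⟩
    exact (key e).2 (h e) s

end EdgeOrientation

theorem eq_vec_of_sub_eq {O O' : EdgeOrientation E} {x : E → ℝ}
    (h : O.vec - O'.vec = (2 : ℝ) • x) {e : E} (he : x e ≠ 0) :
    O.vec e = x e ∧ O'.vec e = - x e := by
  have := congrFun h e
  simp only [Pi.sub_apply, Pi.smul_apply, smul_eq_mul] at this
  rcases O.vec_eq e with h1 | h1 <;> rcases O'.vec_eq e with h2 | h2 <;> rw [h1, h2] at this ⊢
  · exact absurd (by linarith) he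
  · constructor <;> linarith
  · constructor <;> linarith
  · exact absurd (by linarith) he

/-! ### Reversal equivalence in terms of the kernel and the row space. -/

/-- Half the difference of the vectors of two orientations is the sum of an integer vector in
the kernel of `A` and an integer vector in the row space of `A`. -/
def IsEquivalent [Fintype E] [Fintype m] (A : Matrix m E ℝ) (O O' : EdgeOrientation E) : Prop :=
  ∃ u ∈ LinearMap.ker A.mulVecLin, ∃ w ∈ LinearMap.range Aᵀ.mulVecLin,
    IsIntVector u ∧ IsIntVector w ∧ O.vec - O'.vec = (2 : ℝ) • (u + w)

section

variable [Fintype E] [Fintype m] {A : Matrix m E ℝ} {M : Matroid E}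

/-- Integrality is the invariant that survives transitivity; sign vectors with disjoint supports
need not add up to such vectors, and are recovered afterwards by `IsEquivalent.exists_disjoint`. -/
theorem isEquivalent_of_eqvGen {O O' : EdgeOrientation E}
    (h : Relation.EqvGen (IsReversal A M) O O') : IsEquivalent A O O' := by
  induction h with
  | rel O O' h =>
    obtain ⟨C, hC, hCO, hO'⟩ := h
    obtain ⟨v, hvs, hv, -, rfl⟩ | ⟨v, hvs, hv, -, rfl⟩ := hC
    all_goals
      have h1 := (O.reversal_iff O' ((O.arcsOf_subset_arcs_iff hvs).1 hCO)).1 hO'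
    · refine ⟨v, hv, 0, zero_mem _, IsSignVector.isIntVector hvs, isIntVector_zero, ?_⟩
      rw [h1]; simp
    · refine ⟨0, zero_mem _, v, hv, isIntVector_zero, IsSignVector.isIntVector hvs, ?_⟩
      rw [h1]; simp
  | refl O => exact ⟨0, zero_mem _, 0, zero_mem _, isIntVector_zero, isIntVector_zero, by simp⟩
  | symm O O' _ ih =>
    obtain ⟨u, hu, w, hw, hui, hwi, h⟩ := ih
    refine ⟨-u, neg_mem hu, -w, neg_mem hw, hui.neg, hwi.neg, ?_⟩
    rw [← neg_sub, h]
    module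
  | trans O O' O'' _ _ ih ih' =>
    obtain ⟨u, hu, w, hw, hui, hwi, h⟩ := ih
    obtain ⟨u', hu', w', hw', hui', hwi', h'⟩ := ih'
    refine ⟨u + u', add_mem hu hu', w + w', add_mem hw hw', hui.add hui', hwi.add hwi', ?_⟩
    rw [← sub_add_sub_cancel _ O'.vec, h, h']
    module

/-- Half the difference of the vectors of two equivalent orientations decomposes into vectors
of the kernel and of the row space with disjoint supports. -/
theorem IsEquivalent.exists_disjoint {O O' : EdgeOrientation E} (h : IsEquivalent A O O') :
    ∃ u ∈ LinearMap.ker A.mulVecLin, ∃ w ∈ LinearMap.range Aᵀ.mulVecLin,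
      IsSignVector u ∧ IsSignVector w ∧ (∀ e, u e = 0 ∨ w e = 0) ∧
      O.vec - O'.vec = (2 : ℝ) • (u + w) := by
  obtain ⟨u, hu, w, hw, hui, -, h⟩ := h
  have hs : IsSignVector (u + w) := by
    intro e
    have := congrFun h e
    simp only [Pi.sub_apply, Pi.smul_apply, smul_eq_mul] at this
    rcases O.vec_eq e with h1 | h1 <;> rcases O'.vec_eq e with h2 | h2 <;> rw [h1, h2] at this
    · left; linarith
    · right; left; linarith
    · right; right; linarith
    · left; linarith
  have hd := hs.eq_zero_or_eq_zero hui (dotProduct_eq_zero_of_mem hu hw)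
  exact ⟨u, hu, w, hw, hs.left hd, IsSignVector.left (add_comm u w ▸ hs) fun e => (hd e).symm, hd, h⟩

/-- Induction on the size of the support of `u + w`: an elementary sign vector agreeing with `u` or
`w` on its support is contained in `O`, and reversing it removes that support. -/
theorem eqvGen_of_isEquivalent (hA : Represents A M)
    (hK : IsRegularSubspace (LinearMap.ker A.mulVecLin))
    (hR : IsRegularSubspace (LinearMap.range Aᵀ.mulVecLin)) {O O' : EdgeOrientation E}
    (h : IsEquivalent A O O') : Relation.EqvGen (IsReversal A M) O O' := by
  obtain ⟨u, hu, w, hw, hus, hws, hd, hsub⟩ := h.exists_disjoint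
  clear h
  rename' hsub => h
  induction hn : (Function.support (u + w)).ncard using Nat.strong_induction_on
    generalizing O u w with
  | _ n ih =>
    subst hn
    -- reversing a signed (co)circuit inside `u` or `w` decreases the support
    have step : ∀ v : E → ℝ, (IsSignedCircuit A M (arcsOf v) ∨ IsSignedCocircuit A M (arcsOf v)) →
        v ≠ 0 → (∀ e, v e ≠ 0 → v e = (u + w) e) →
        (∀ O₁ : EdgeOrientation E, O₁.vec - O'.vec = (2 : ℝ) • (u + w - v) →
          (Function.support (u + w - v)).ncard < (Function.support (u + w)).ncard →
          Relation.EqvGen (IsReversal A M) O₁ O') →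
        Relation.EqvGen (IsReversal A M) O O' := by
      intro v hC hv0 hvx hind
      have hvO : ∀ e, v e ≠ 0 → v e = O.vec e := by
        intro e he
        rw [(eq_vec_of_sub_eq h (hvx e he ▸ he)).1, hvx e he]
      obtain ⟨O₁, hO₁⟩ := EdgeOrientation.exists_vec_eq (x := O.vec - (2 : ℝ) • v) (by
        intro e
        by_cases he : v e = 0
        · simpa [he] using O.vec_eq e
        · have := O.vec_eq e
          simp only [Pi.sub_apply, Pi.smul_apply, smul_eq_mul, hvO e he]
          rcases this with h | h <;> rw [h] <;> norm_num)
      have hvs : IsSignVector v := by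
        intro e
        by_cases he : v e = 0
        · exact Or.inl he
        · exact Or.inr (hvO e he ▸ O.vec_eq e)
      refine (Relation.EqvGen.rel _ _ ⟨arcsOf v, hC, (O.arcsOf_subset_arcs_iff hvs).2 hvO,
        (O.reversal_iff O₁ hvO).2 hO₁⟩).trans _ _ _ (hind O₁ ?_ ?_)
      · rw [hO₁, sub_right_comm, h]
        module
      · obtain ⟨e, he⟩ := Function.ne_iff.1 hv0
        refine Set.ncard_lt_ncard ⟨fun f hf hf0 => hf ?_, fun hsub => ?_⟩ (Set.toFinite _)
        · by_cases hvf : v f = 0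
          · rw [Pi.sub_apply, hf0, hvf, sub_zero]
          · rw [Pi.sub_apply, hvx f hvf, sub_self]
        · have : e ∈ Function.support (u + w) := by
            rw [Function.mem_support, ← hvx e he]; exact he
          exact hsub this (by rw [Pi.sub_apply, hvx e he, sub_self])
    by_cases hu0 : u = 0
    · by_cases hw0 : w = 0
      · have : O = O' := EdgeOrientation.vec_injective (by
          rw [← sub_eq_zero, h, hu0, hw0]; simp)
        exact this ▸ Relation.EqvGen.refl _
      · obtain ⟨v, hv, hvs, hvw⟩ := hR.exists_isElementary hw hw0 hws
        refine step v (Or.inr ⟨v, hvs, hv.mem, hv.isCocircuit hA, rfl⟩) hv.ne_zero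
          (fun e he => by simp [hu0, hvw e he]) fun O₁ hO₁ hlt => ?_
        rw [add_sub_assoc] at hO₁ hlt
        have hwv : IsSignVector (w - v) := by
          intro e
          by_cases he : v e = 0
          · simpa [he] using hws e
          · simp [hvw e he]
        exact ih _ hlt u hu (w - v) (sub_mem hw hv.mem) hus hwv (by simp [hu0]) hO₁ rfl
    · obtain ⟨v, hv, hvs, hvu⟩ := hK.exists_isElementary hu hu0 hus
      have hwz : ∀ e, v e ≠ 0 → w e = 0 := fun e he =>
        (hd e).resolve_left (hvu e he ▸ he)
      refine step v (Or.inl ⟨v, hvs, hv.mem, hv.isCircuit hA, rfl⟩) hv.ne_zero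
        (fun e he => by simp [hwz e he, hvu e he]) fun O₁ hO₁ hlt => ?_
      rw [add_sub_right_comm] at hO₁ hlt
      have huv : ∀ e, (u - v) e = 0 ∨ (u - v) e = u e := by
        intro e
        by_cases he : v e = 0
        · right; simp [he]
        · left; simp [hvu e he]
      refine ih _ hlt (u - v) (sub_mem hu hv.mem) w hw ?_ hws ?_ hO₁ rfl
      · intro e
        rcases huv e with h | h
        · exact Or.inl h
        · rw [h]; exact hus e
      · intro e
        rcases huv e with h | h
        · exact Or.inl h
        · rw [h]; exact hd e

end

/-! ### Cauchy–Binet and the number of bases. -/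

/-- Row `i` of the Gram matrix is the combination of the columns of `N` with coefficients `N i e`;
the determinant is expanded multilinearly in the rows. The sum runs over all maps, to be grouped by
image. -/
theorem det_mul_transpose_eq_sum {κ R : Type*} [Fintype κ] [DecidableEq κ] [Fintype E]
    [CommRing R] (N : Matrix κ E R) :
    (N * Nᵀ).det = ∑ f : κ → E, (∏ i, N i (f i)) * (N.submatrix id f).det := by
  classical
  have h1 : (N * Nᵀ) = fun i => ∑ e, N i e • Nᵀ e := by
    ext i j
    simp [Matrix.mul_apply]
  have h2 : (N * Nᵀ).det = (Matrix.detRowAlternating (n := κ) (R := R)).toMultilinearMap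
      (fun i => ∑ e, N i e • Nᵀ e) := by
    rw [← h1]; rfl
  rw [h2, MultilinearMap.map_sum]
  refine Finset.sum_congr rfl fun f _ => ?_
  rw [MultilinearMap.map_smul_univ, smul_eq_mul]
  congr 1
  change Matrix.det (fun i => Nᵀ (f i)) = _
  rw [← Matrix.det_transpose]
  rfl

/-- The contributions to the Cauchy–Binet expansion of the maps with a given image add up to
the square of a maximal minor. -/
theorem sum_image_eq_det_sq {κ R : Type*} [Fintype κ] [DecidableEq κ] [Fintype E] [DecidableEq E]
    [CommRing R] (N : Matrix κ E R) {g : κ → E} (hg : Function.Injective g) :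
    ∑ f : κ → E with Finset.univ.image f = Finset.univ.image g,
      (∏ i, N i (f i)) * (N.submatrix id f).det = (N.submatrix id g).det ^ 2 := by
  -- One factor is expanded by Leibniz, its signs absorbed by the other. The maps `g ∘ σ` are
  -- exactly those with the image of `g`.
  have hsq : (N.submatrix id g).det ^ 2 =
      ∑ σ : Equiv.Perm κ, (∏ i, N i (g (σ i))) * (N.submatrix id (g ∘ σ)).det := by
    rw [sq]
    nth_rewrite 1 [← Matrix.det_transpose]
    rw [Matrix.det_apply', Finset.sum_mul]
    refine Finset.sum_congr rfl fun σ _ => ?_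
    have hperm : (N.submatrix id (g ∘ σ)).det =
        Equiv.Perm.sign σ * (N.submatrix id g).det :=
      Matrix.det_permute' σ (N.submatrix id g)
    have hprod : ∏ i, (N.submatrix id g)ᵀ (σ i) i = ∏ i, N i (g (σ i)) := rfl
    rw [hperm, hprod]
    ring
  rw [hsq]
  symm
  refine Finset.sum_bij (fun σ _ => g ∘ σ) ?_ ?_ ?_ ?_
  · intro σ _
    simp only [Finset.mem_filter, Finset.mem_univ, true_and]
    ext e
    simp only [Finset.mem_image, Finset.mem_univ, true_and, Function.comp_apply]
    exact (σ.surjective.exists (p := fun i => g i = e)).symm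
  · intro σ _ τ _ h
    ext i
    exact hg (congrFun h i)
  · intro f hf
    simp only [Finset.mem_filter, Finset.mem_univ, true_and] at hf
    have hmem : ∀ i, ∃ j, g j = f i := by
      intro i
      have : f i ∈ Finset.univ.image g := hf ▸ Finset.mem_image_of_mem f (Finset.mem_univ i)
      simpa using this
    choose σ hσ using hmem
    have hsurj : Function.Surjective σ := by
      intro j
      have : g j ∈ Finset.univ.image f := hf ▸ Finset.mem_image_of_mem g (Finset.mem_univ j)
      obtain ⟨i, -, hi⟩ := Finset.mem_image.1 this
      exact ⟨i, hg (by rw [hσ, hi])⟩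
    exact ⟨Equiv.ofBijective σ (Finite.surjective_iff_bijective.1 hsurj), Finset.mem_univ _,
      funext hσ⟩
  · intro σ _
    rfl

/-- The columns chosen are independent, and no independent set exceeds the number of rows. -/
theorem isBase_range_of_det_ne_zero {κ : Type*} [Fintype κ] [DecidableEq κ] [Fintype E]
    {N : Matrix κ E ℝ} {M : Matroid E} (hN : Represents N M) {g : κ → E}
    (hg : Function.Injective g) (hdet : (N.submatrix id g).det ≠ 0) : M.IsBase (Set.range g) := by
  have hli : LinearIndependent ℝ (N.submatrix id g).col :=
    Matrix.linearIndependent_cols_iff_isUnit.2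
      ((Matrix.isUnit_iff_isUnit_det _).2 (isUnit_iff_ne_zero.2 hdet))
  have hind : M.Indep (Set.range g) := by
    rw [hN.indep_iff]
    exact (linearIndepOn_range_iff hg _).2 hli
  refine hind.isBase_of_maximal fun J hJ hgJ => ?_
  refine Set.eq_of_subset_of_ncard_le hgJ ?_ (Set.toFinite _)
  rw [hN.indep_iff] at hJ
  have := Fintype.ofFinite J
  have h1 := LinearIndependent.fintype_card_le_finrank hJ
  rw [Module.finrank_fintype_fun_eq_card] at h1
  rw [← Set.image_univ, Set.ncard_image_of_injective _ hg, Set.ncard_univ, Nat.card_eq_fintype_card,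
    ← Nat.card_coe_set_eq, Nat.card_eq_fintype_card]
  exact h1

/-- For a totally unimodular representation, the determinant of the Gram matrix of the rows is at
most the number of bases. -/
theorem det_mul_transpose_le_card_basis {κ : Type*} [Fintype κ] [DecidableEq κ] [Fintype E]
    {N : Matrix κ E ℝ} {M : Matroid E} (hTU : N.IsTotallyUnimodular) (hN : Represents N M) :
    (N * Nᵀ).det ≤ Nat.card (Basis M) := by
  classical
  rw [det_mul_transpose_eq_sum, ← Finset.sum_fiberwise (g := fun f : κ → E => Finset.univ.image f)]
  have hterm : ∀ S : Finset E, ∑ f : κ → E with Finset.univ.image f = S,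
      (∏ i, N i (f i)) * (N.submatrix id f).det ≤ if M.IsBase (S : Set E) then 1 else 0 := by
    intro S
    by_cases hS : ∃ g : κ → E, Finset.univ.image g = S ∧ (N.submatrix id g).det ≠ 0
    · obtain ⟨g, rfl, hdet⟩ := hS
      have hg : Function.Injective g := by
        intro i j hij
        by_contra hne
        exact hdet (Matrix.det_zero_of_column_eq hne fun k => by simp [hij])
      rw [sum_image_eq_det_sq N hg, if_pos (by
        simpa using isBase_range_of_det_ne_zero hN hg hdet)]
      rw [isTotallyUnimodular_iff_fintype] at hTU
      obtain ⟨s, hs⟩ := hTU κ id g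
      rw [← hs]
      cases s <;> simp
    · push Not at hS
      rw [Finset.sum_eq_zero]
      · split_ifs <;> simp
      · intro f hf
        rw [hS f (by simpa using hf), mul_zero]
  refine (Finset.sum_le_sum fun S _ => hterm S).trans ?_
  rw [Finset.sum_boole]
  norm_cast
  have : Fintype (Basis M) := Fintype.ofFinite _
  rw [Nat.card_eq_fintype_card, ← Finset.card_univ]
  refine Finset.card_le_card_of_surjOn (fun B => (B.1).toFinite.toFinset) ?_
  intro S hS
  exact ⟨⟨S, by simpa using hS⟩, by simp, Set.toFinite_toFinset _ |>.trans (Finset.toFinset_coe S)⟩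

/-! ### Counting reversal classes in the cokernel of the Gram matrix. -/

theorem natCard_quotient_range_mulVecLin {κ : Type*} [Fintype κ] [DecidableEq κ]
    (G : Matrix κ κ ℤ) (hG : G.det ≠ 0) :
    Nat.card ((κ → ℤ) ⧸ LinearMap.range (R := ℤ) G.mulVecLin) = G.det.natAbs := by
  have hinj : Function.Injective G.mulVecLin :=
    Matrix.mulVec_injective_of_det_ne_zero hG
  rw [← Submodule.natAbs_det_equiv _ (LinearEquiv.ofInjective _ hinj)]
  congr 1
  rw [← LinearMap.det_toLin']
  rfl

/-- A set of rows forming a basis of the row space. -/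
theorem exists_row_basis.{v} {m : Type v} [Fintype E] [Fintype m] (A : Matrix m E ℝ) :
    ∃ (κ : Type v) (_ : Fintype κ) (a : κ → m), LinearIndependent ℝ (A.submatrix a id).row ∧
      LinearMap.range (A.submatrix a id)ᵀ.mulVecLin = LinearMap.range Aᵀ.mulVecLin ∧
      LinearMap.ker (A.submatrix a id).mulVecLin = LinearMap.ker A.mulVecLin := by
  obtain ⟨κ, a, ha, hspan, hli⟩ := exists_linearIndependent' ℝ A.row
  have := Fintype.ofInjective a ha
  have hrange : LinearMap.range (A.submatrix a id)ᵀ.mulVecLin = LinearMap.range Aᵀ.mulVecLin := by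
    rw [Matrix.range_mulVecLin, Matrix.range_mulVecLin]
    exact hspan
  refine ⟨κ, this, a, hli, hrange, ?_⟩
  ext v
  constructor
  · intro hv
    rw [LinearMap.mem_ker]
    ext i
    have h1 : A.row i ∈ LinearMap.range (A.submatrix a id)ᵀ.mulVecLin := by
      rw [hrange, Matrix.range_mulVecLin]
      exact Submodule.subset_span ⟨i, rfl⟩
    have := dotProduct_eq_zero_of_mem hv h1
    rwa [dotProduct_comm] at this
  · intro hv
    rw [LinearMap.mem_ker] at hv ⊢
    ext i
    exact congrFun hv (a i)

theorem exists_int_map_eq {A : Matrix m E ℝ} (hA : A.IsTotallyUnimodular) :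
    ∃ Z : Matrix m E ℤ, Z.map (Int.cast : ℤ → ℝ) = A := by
  choose s hs using fun i => fun e => hA.apply i e
  refine ⟨Matrix.of fun i e => (s i e : ℤ), ?_⟩
  ext i e
  rw [← hs]
  simp

theorem map_intCast_mulVec [Fintype E] (Q : Matrix m E ℤ) (z : E → ℤ) :
    (Q.map (Int.cast : ℤ → ℝ)).mulVec (fun e => (z e : ℝ)) =
      fun i => ((Q.mulVec z i : ℤ) : ℝ) := by
  ext i
  simp [Matrix.mulVec, dotProduct]

/-- There are at most as many circuit-cocircuit reversal classes as bases: the classes embed into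
the cokernel of the Gram matrix of a basis of the row space. -/
theorem card_reversalClass_le [Fintype E] [Fintype m] {M : Matroid E} {A : Matrix m E ℝ}
    (hTU : A.IsTotallyUnimodular) (hA : Represents A M)
    (hK : IsRegularSubspace (LinearMap.ker A.mulVecLin))
    (hR : IsRegularSubspace (LinearMap.range Aᵀ.mulVecLin)) :
    Nat.card (ReversalClass A M) ≤ Nat.card (Basis M) := by
  classical
  obtain ⟨κ, _, a, hli, hrange, hker⟩ := exists_row_basis A
  set N := A.submatrix a id with hNdef
  have hNTU : N.IsTotallyUnimodular := hTU.submatrix _ _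
  have hN : Represents N M := ⟨hA.ground_eq, fun I => by
    rw [hA.indep_iff_ker, linearIndepOn_col_iff, hker]⟩
  obtain ⟨Z, hZ⟩ := exists_int_map_eq hNTU
  have hGmap : (Z * Zᵀ).map (Int.cast : ℤ → ℝ) = N * Nᵀ := by
    rw [← hZ, ← Matrix.transpose_map]
    exact Matrix.map_mul (f := Int.castRingHom ℝ)
  have hGdet : (((Z * Zᵀ).det : ℤ) : ℝ) = (N * Nᵀ).det := by
    rw [← hGmap, ← Int.cast_det]
  have hpos : 0 < (N * Nᵀ).det := by
    have := (Matrix.PosDef.mul_conjTranspose_self N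
      (Matrix.vecMul_injective_iff.2 hli)).det_pos
    simpa using this
  have hne : (Z * Zᵀ).det ≠ 0 := by
    intro h
    rw [h] at hGdet
    simp at hGdet
    exact hpos.ne hGdet
  have hcard : Nat.card ((κ → ℤ) ⧸ LinearMap.range (Z * Zᵀ).mulVecLin) ≤ Nat.card (Basis M) := by
    rw [natCard_quotient_range_mulVecLin _ hne]
    have := det_mul_transpose_le_card_basis hNTU hN
    rw [← hGdet] at this hpos
    zify
    rw [abs_of_pos (by exact_mod_cast hpos)]
    exact_mod_cast this
  refine le_trans ?_ hcard
  have hfin : Finite ((κ → ℤ) ⧸ LinearMap.range (Z * Zᵀ).mulVecLin) := by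
    apply Nat.finite_of_card_ne_zero
    rw [natCard_quotient_range_mulVecLin _ hne]
    exact Int.natAbs_ne_zero.2 hne
  -- the indicator vector of the edges oriented positively
  have hx : ∀ O : EdgeOrientation E, ∃ x : E → ℤ, ∀ e, O.vec e = 2 * (x e : ℝ) - 1 := by
    intro O
    refine ⟨fun e => if O.vec e = 1 then 1 else 0, fun e => ?_⟩
    rcases O.vec_eq e with h | h
    · simp [h]; norm_num
    · have : ¬ (-1 : ℝ) = 1 := by norm_num
      simp [h, this]
  choose x hx using hx
  -- Built from chosen representatives: only injectivity matters, so invariance under reversals need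
  -- not be checked.
  let φ : ReversalClass A M → (κ → ℤ) ⧸ LinearMap.range (Z * Zᵀ).mulVecLin := fun c =>
    Submodule.Quotient.mk (Z.mulVec (x c.out))
  refine Nat.card_le_card_of_injective φ fun c c' h => ?_
  rw [← c.out_eq, ← c'.out_eq]
  apply Quotient.sound
  refine eqvGen_of_isEquivalent hA hK hR ?_
  obtain ⟨y, hy⟩ := (Submodule.Quotient.eq _).1 h
  rw [Matrix.mulVecLin_apply, ← Matrix.mulVec_mulVec, ← Matrix.mulVec_sub] at hy
  -- Equal images mean that `Z` maps the difference of the indicators to `Z Zᵀ y`; removing `Zᵀ y`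
  -- leaves a kernel vector, and both parts are integral.
  let w : E → ℤ := Zᵀ.mulVec y
  let u : E → ℤ := x c.out - x c'.out - w
  have hu : Z.mulVec u = 0 := by rw [Matrix.mulVec_sub, ← hy, sub_self]
  refine ⟨fun e => (u e : ℝ), ?_, fun e => (w e : ℝ), ?_, fun e => ⟨u e, rfl⟩,
    fun e => ⟨w e, rfl⟩, ?_⟩
  · rw [← hker, LinearMap.mem_ker, Matrix.mulVecLin_apply, ← hZ, map_intCast_mulVec, hu]
    ext; simp
  · rw [← hrange, ← hZ, ← Matrix.transpose_map]
    exact ⟨fun i => (y i : ℝ), map_intCast_mulVec _ _⟩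
  · ext e
    simp only [Pi.sub_apply, Pi.smul_apply, Pi.add_apply, smul_eq_mul, hx, u]
    push_cast
    ring

/-! ### Injectivity on bases. -/

theorem isOneWay_iff {F : Fourientation E} {e : E} {s : ℤˣ} (h : IsOneWay F e) (hs : (e, s) ∈ F)
    (t : ℤˣ) : (e, t) ∈ F ↔ t = s :=
  ⟨fun ht => h.unique ht hs, fun ht => ht ▸ hs⟩

theorem arcsOf_subset_iff {v : E → ℝ} {F : Fourientation E} :
    arcsOf v ⊆ F ↔ ∀ (e : E) (s : ℤˣ), v e = ((s : ℤ) : ℝ) → (e, s) ∈ F :=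
  ⟨fun h _ _ hs => h hs, fun h a ha => h a.1 a.2 ha⟩

theorem ne_neg_unit (s : ℤˣ) : s ≠ -s := by
  rcases Int.units_eq_one_or s with rfl | rfl <;> decide

section

variable {M : Matroid E} (𝒜 : ExternalAtlas M) (𝒜' : InternalAtlas M)

/-- On an edge where the orientations attached to two bases agree, the two fourientations attached
to the pair of bases agree as well. -/
theorem mem_inter_iff_of_vec_eq {B₁ B₂ : Basis M} {e : E}
    (h : (orientationOfBasis 𝒜 𝒜' B₁).vec e = (orientationOfBasis 𝒜 𝒜' B₂).vec e) (t : ℤˣ) :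
    (e, t) ∈ 𝒜.orient B₁ ∩ reverse (𝒜.orient B₂) ↔
      (e, t) ∈ (𝒜'.orient B₁ ∩ reverse (𝒜'.orient B₂))ᶜ := by
  obtain ⟨s, hs₁, -⟩ := (orientationOfBasis 𝒜 𝒜' B₁).isOneWay e
  have hs₂ : (e, s) ∈ (orientationOfBasis 𝒜 𝒜' B₂).arcs := by
    rw [EdgeOrientation.mem_arcs_iff] at hs₁ ⊢
    rw [← h, hs₁]
  obtain ⟨h₁, h₁'⟩ := hs₁
  obtain ⟨h₂, h₂'⟩ := hs₂
  have hext : ∀ B : Basis M, (e, s) ∈ 𝒜.orient B → (e, s) ∈ 𝒜'.orient B →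
      ((∀ t, (e, t) ∈ 𝒜.orient B) ∧ ∀ t, (e, t) ∈ 𝒜'.orient B ↔ t = s) ∨
      ((∀ t, (e, t) ∈ 𝒜.orient B ↔ t = s) ∧ ∀ t, (e, t) ∈ 𝒜'.orient B) := by
    intro B hB hB'
    by_cases he : e ∈ B.1
    · exact Or.inl ⟨𝒜.internal B e he, isOneWay_iff (𝒜'.internal B e he) hB'⟩
    · exact Or.inr ⟨isOneWay_iff (𝒜.external B e he) hB, 𝒜'.external B e he⟩
  have hs := ne_neg_unit s
  have hcase : t = s ∨ t = -s := by
    rcases Int.units_eq_one_or s with rfl | rfl <;> rcases Int.units_eq_one_or t with rfl | rfl <;>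
      simp
  simp only [Set.mem_inter_iff, Set.mem_compl_iff, mem_reverse]
  rcases hext B₁ h₁ h₁' with ⟨a, b⟩ | ⟨a, b⟩ <;> rcases hext B₂ h₂ h₂' with ⟨c, d⟩ | ⟨c, d⟩ <;>
    rcases hcase with rfl | rfl <;> simp [a, b, c, d, hs.symm]

variable {𝒜 𝒜'}

theorem mem_of_sub_eq {B₁ B₂ : Basis M} {x : E → ℝ}
    (h : (orientationOfBasis 𝒜 𝒜' B₁).vec - (orientationOfBasis 𝒜 𝒜' B₂).vec = (2 : ℝ) • x)
    {e : E} {s : ℤˣ} (hs : x e = ((s : ℤ) : ℝ)) :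
    (e, s) ∈ 𝒜.orient B₁ ∩ reverse (𝒜.orient B₂) ∧
      (e, s) ∈ 𝒜'.orient B₁ ∩ reverse (𝒜'.orient B₂) := by
  have h0 : x e ≠ 0 := by rw [hs]; simp
  obtain ⟨h1, h2⟩ := eq_vec_of_sub_eq h h0
  have h1' : (e, s) ∈ (orientationOfBasis 𝒜 𝒜' B₁).arcs := by
    rw [EdgeOrientation.mem_arcs_iff, h1, hs]
  have h2' : (e, -s) ∈ (orientationOfBasis 𝒜 𝒜' B₂).arcs := by
    rw [EdgeOrientation.mem_arcs_iff, h2, hs]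
    simp
  exact ⟨⟨h1'.1, h2'.1⟩, ⟨h1'.2, h2'.2⟩⟩

theorem vec_eq_of_eq_zero {O O' : EdgeOrientation E} {x : E → ℝ}
    (h : O.vec - O'.vec = (2 : ℝ) • x) {e : E} (he : x e = 0) : O.vec e = O'.vec e := by
  have := congrFun h e
  simp only [Pi.sub_apply, Pi.smul_apply, smul_eq_mul, he] at this
  linarith

end

theorem IsSignVector.exists_unit {v : E → ℝ} (hv : IsSignVector v) {e : E} (he : v e ≠ 0) :
    ∃ s : ℤˣ, v e = ((s : ℤ) : ℝ) := by
  rcases hv e with h | h | h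
  · exact absurd h he
  · exact ⟨1, by simp [h]⟩
  · exact ⟨-1, by simp [h]⟩

theorem IsSignVector.eq_unit_of_mul_pos {v : E → ℝ} (hv : IsSignVector v) {e : E} {s : ℤˣ}
    (h : 0 < ((s : ℤ) : ℝ) * v e) : v e = ((s : ℤ) : ℝ) := by
  rcases hv e with h' | h' | h' <;> rcases Int.units_eq_one_or s with rfl | rfl <;>
    simp [h'] at h ⊢
  all_goals linarith

/-- Orthogonal vectors whose entries never have equal signs have disjoint supports. -/
theorem eq_zero_of_dotProduct_eq_zero [Fintype E] {c x : E → ℝ} (h : c ⬝ᵥ x = 0)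
    (hle : ∀ e, c e * x e ≤ 0) {e : E} (he : c e ≠ 0) : x e = 0 := by
  have h1 : ∑ f, - (c f * x f) = 0 := by
    rw [Finset.sum_neg_distrib, neg_eq_zero]; exact h
  have := (Finset.sum_eq_zero_iff_of_nonneg fun f _ => neg_nonneg.2 (hle f)).1 h1 e
    (Finset.mem_univ _)
  exact (mul_eq_zero.1 (neg_eq_zero.1 this)).resolve_left he

section

variable [Fintype E] [Fintype m] {M : Matroid E} {A : Matrix m E ℝ} {𝒜 : ExternalAtlas M}
  {𝒜' : InternalAtlas M}

theorem eq_of_isEquivalent_of_external (hA : Represents A M)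
    (hK : IsRegularSubspace (LinearMap.ker A.mulVecLin))
    (hdiss' : 𝒜'.IsDissecting A) (htri : 𝒜.IsTriangulating A) {B₁ B₂ : Basis M}
    (h : IsEquivalent A (orientationOfBasis 𝒜 𝒜' B₁) (orientationOfBasis 𝒜 𝒜' B₂)) :
    B₁ = B₂ := by
  by_contra hne
  obtain ⟨u, hu, w, hw, hus, hws, hd, h⟩ := h.exists_disjoint
  have hu0 : u = 0 := by
    by_contra hu0
    obtain ⟨v, hv, hvs, hvu⟩ := hK.exists_isElementary hu hu0 hus
    refine htri B₁ B₂ hne ⟨arcsOf v, ⟨v, hvs, hv.mem, hv.isCircuit hA, rfl⟩, ?_⟩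
    rw [arcsOf_subset_iff]
    intro e s hs
    have he : v e ≠ 0 := by rw [hs]; simp
    have hue := hvu e he
    have hwe : w e = 0 := (hd e).resolve_left (hue ▸ he)
    exact (mem_of_sub_eq h (e := e) (s := s) (by simp [hwe, ← hue, hs])).1
  rw [hu0, zero_add] at h
  obtain ⟨_, ⟨c, hcs, hc, hcirc, rfl⟩, hsub⟩ := hdiss' B₁ B₂ hne
  rw [arcsOf_subset_iff] at hsub
  refine htri B₁ B₂ hne ⟨_, ⟨c, hcs, hc, hcirc, rfl⟩, ?_⟩
  rw [arcsOf_subset_iff]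
  intro e s hs
  -- Where `w` is nonzero its arcs lie in `𝒜'.orient B₁ ∩ reverse (𝒜'.orient B₂)`, while those of
  -- `c` avoid this set; hence `c f * w f ≤ 0` throughout, and orthogonality gives zero.
  have hw0 : w e = 0 := by
    refine eq_zero_of_dotProduct_eq_zero (dotProduct_eq_zero_of_mem hc hw) (fun f => ?_)
      (by rw [hs]; simp : c e ≠ 0)
    by_contra! hpos
    obtain ⟨t, ht⟩ := IsSignVector.exists_unit hcs (left_ne_zero_of_mul hpos.ne')
    have hwt : w f = ((t : ℤ) : ℝ) := hws.eq_unit_of_mul_pos (ht ▸ hpos)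
    exact hsub f t ht (mem_of_sub_eq h hwt).2
  exact (mem_inter_iff_of_vec_eq 𝒜 𝒜' (vec_eq_of_eq_zero h hw0) s).2 (hsub e s hs)

theorem eq_of_isEquivalent_of_internal (hA : Represents A M)
    (hR : IsRegularSubspace (LinearMap.range Aᵀ.mulVecLin))
    (hdiss : 𝒜.IsDissecting A) (htri' : 𝒜'.IsTriangulating A) {B₁ B₂ : Basis M}
    (h : IsEquivalent A (orientationOfBasis 𝒜 𝒜' B₁) (orientationOfBasis 𝒜 𝒜' B₂)) :
    B₁ = B₂ := by
  by_contra hne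
  obtain ⟨u, hu, w, hw, hus, hws, hd, h⟩ := h.exists_disjoint
  have hw0 : w = 0 := by
    by_contra hw0
    -- The cocircuit is taken inside `-w` because potential cocircuits of `F` lie in `-Fᶜ`; the same
    -- reversal explains `-c` below.
    obtain ⟨v, hv, hvs, hvw⟩ := hR.exists_isElementary (neg_mem hw) (neg_ne_zero.2 hw0) hws.neg
    refine htri' B₁ B₂ hne ⟨arcsOf v, ⟨v, hvs, hv.mem, hv.isCocircuit hA, rfl⟩, ?_⟩
    rw [arcsOf_subset_iff]
    intro e s hs
    have he : v e ≠ 0 := by rw [hs]; simp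
    have hwe : w e = - v e := by rw [hvw e he]; simp
    have hue : u e = 0 := (hd e).resolve_right (by rw [hwe]; simpa using he)
    rw [mem_reverse, compl_compl]
    exact (mem_of_sub_eq h (e := e) (s := -s) (by simp [hue, hwe, hs])).2
  rw [hw0, add_zero] at h
  obtain ⟨_, ⟨c, hcs, hc, hcirc, rfl⟩, hsub⟩ := hdiss B₁ B₂ hne
  rw [arcsOf_subset_iff] at hsub
  refine htri' B₁ B₂ hne ⟨_, ⟨c, hcs, hc, hcirc, rfl⟩, ?_⟩
  rw [arcsOf_subset_iff]
  intro e s hs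
  have hu0 : u e = 0 := by
    have hdot : (-c) ⬝ᵥ u = 0 := by
      rw [neg_dotProduct, dotProduct_comm, dotProduct_eq_zero_of_mem hu hc, neg_zero]
    refine eq_zero_of_dotProduct_eq_zero hdot (fun f => ?_) (by simp [hs] : (-c) e ≠ 0)
    by_contra! hpos
    obtain ⟨t, ht⟩ := IsSignVector.exists_unit hcs
      (neg_ne_zero.1 (left_ne_zero_of_mul hpos.ne' : -c f ≠ 0))
    have hut : u f = (((-t : ℤˣ) : ℤ) : ℝ) := hus.eq_unit_of_mul_pos (by simpa [ht] using hpos)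
    exact hsub f t ht (mem_of_sub_eq h hut).1
  have hiff := mem_inter_iff_of_vec_eq 𝒜 𝒜' (vec_eq_of_eq_zero h hu0) (-s)
  rw [mem_reverse, Set.mem_compl_iff, ← hiff]
  exact hsub e s hs

end

theorem isRegularSubspace_range_of_isTotallyUnimodular [Fintype E] [Fintype m] {A : Matrix m E ℝ}
    (hA : A.IsTotallyUnimodular) : IsRegularSubspace (LinearMap.range Aᵀ.mulVecLin) := by
  obtain ⟨κ, _, a, hli, hrange, -⟩ := exists_row_basis A
  rw [← hrange]
  exact isRegularSubspace_range (hA.submatrix _ _) hli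

end RegularMatroid

theorem theorem1p5 {E m : Type*} [Fintype E] [Fintype m] (M : Matroid E) (A : Matrix m E ℝ)
    (hTU : A.IsTotallyUnimodular) (hA : RegularMatroid.Represents A M)
    (𝒜 : RegularMatroid.ExternalAtlas M) (𝒜' : RegularMatroid.InternalAtlas M)
    (hdiss : 𝒜.IsDissecting A) (hdiss' : 𝒜'.IsDissecting A)
    (htri : 𝒜.IsTriangulating A ∨ 𝒜'.IsTriangulating A) :
    Function.Bijective (fun B : RegularMatroid.Basis M =>
      (Quotient.mk (RegularMatroid.reversalSetoid A M)
        (RegularMatroid.orientationOfBasis 𝒜 𝒜' B) : RegularMatroid.ReversalClass A M)) := by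
  have hK := RegularMatroid.isRegularSubspace_ker hTU
  have hR := RegularMatroid.isRegularSubspace_range_of_isTotallyUnimodular hTU
  -- Finiteness of the set of classes is needed, since `Nat.card` of an infinite type is 0.
  have : Finite (RegularMatroid.EdgeOrientation E) :=
    Finite.of_injective RegularMatroid.EdgeOrientation.arcs fun O O' h => by
      cases O; cases O'; simpa using h
  refine Function.Injective.bijective_of_nat_card_le (fun B₁ B₂ h => ?_)
    (RegularMatroid.card_reversalClass_le hTU hA hK hR)
  have hequiv := RegularMatroid.isEquivalent_of_eqvGen (Quotient.exact h)
  rcases htri with htri | htri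
  · exact RegularMatroid.eq_of_isEquivalent_of_external hA hK hdiss' htri hequiv
  · exact RegularMatroid.eq_of_isEquivalent_of_internal hA hR hdiss htri hequiv
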